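/- Let $R$ be a prime ring (associative, not necessarily unital), with center $Z(R)$ and extended centroid $C$, the center of the symmetric Martindale ring of quotients $Q_s(R)\supseteq R$. A Lie ideal of $R$ is an additive subgroup $L$ with $ar-ra\in L$ for all $a\in L$, $r\in R$; it is noncentral if $L\not\subseteq Z(R)$. For additive subgroups $A,B$ of $R$ (or of $Q_s(R)$), $AB$ denotes the additive subgroup generated by all products $ab$ with $a\in A$, $b\in B$. Let $K_1,\ldots,K_m$ be noncentral Lie ideals of $R$, where $m\ge 2$. Then $K_1K_2\cdots K_m$ contains a nonzero (two-sided) ideal of $R$ except precisely when $$K_1C=K_jC=Ca+C\qquad\text{for all } 1\le j\le m \text{ and all } a\in K_1\setminus Z(R);$$ that is, if this condition fails then $K_1K_2\cdots K_m$ contains a nonzero ideal of $R$, and if it holds then $K_1K_2\cdots K_m$ contains no nonzero ideal of $R$. -/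

import Mathlib

/-- A (nonzero, associative, not necessarily unital) ring is prime if `a R b = 0` forces `a = 0`
or `b = 0`. -/
class IsPrimeRing (R : Type*) [NonUnitalRing R] : Prop extends Nontrivial R where
  eq_zero_or_eq_zero : ∀ a b : R, (∀ r : R, a * r * b = 0) → a = 0 ∨ b = 0

/-- An additive subgroup `L` of `R` is a Lie ideal if `[L, R] ⊆ L`. -/
def IsLieIdeal {R : Type*} [NonUnitalRing R] (L : AddSubgroup R) : Prop :=
  ∀ a ∈ L, ∀ r : R, a * r - r * a ∈ L

/-- A Lie ideal (more generally, an additive subgroup) is central if it lies in the center. -/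
def IsCentral {R : Type*} [NonUnitalRing R] (L : AddSubgroup R) : Prop :=
  ∀ a ∈ L, a ∈ Set.center R

open scoped Pointwise in
/-- The product `K 0 * K 1 * ⋯ * K n` of additive subgroups of a ring; here `A * B` is the additive
subgroup generated by all `a * b` with `a ∈ A` and `b ∈ B`. -/
def lieProd {R : Type*} [NonUnitalRing R] :
    (n : ℕ) → (Fin (n + 1) → AddSubgroup R) → AddSubgroup R
  | 0, K => K 0
  | n + 1, K => lieProd n (fun i => K i.castSucc) * K (Fin.last (n + 1))

/-! ### The Martindale rings of quotients of a prime ring -/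

namespace Martindale

section Ideals

variable {R : Type*} [NonUnitalRing R]

/-- The product of two two-sided ideals. -/
def idealMul (I J : TwoSidedIdeal R) : TwoSidedIdeal R :=
  TwoSidedIdeal.span {z | ∃ x ∈ I, ∃ y ∈ J, z = x * y}

theorem idealMul_induction {I J : TwoSidedIdeal R} {p : R → Prop}
    (hmul : ∀ x ∈ I, ∀ y ∈ J, p (x * y)) (h0 : p 0)
    (hadd : ∀ x ∈ idealMul I J, ∀ y ∈ idealMul I J, p x → p y → p (x + y))
    (hneg : ∀ x ∈ idealMul I J, p x → p (-x))
    {z : R} (hz : z ∈ idealMul I J) : p z := by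
  have key : ∀ w : R, w ∈ idealMul I J ↔
      w ∈ AddSubgroup.closure {z : R | ∃ x ∈ I, ∃ y ∈ J, z = x * y} := fun w =>
    TwoSidedIdeal.mem_span_iff_mem_addSubgroup_closure_absorbing (by
      rintro a _ ⟨x, hx, y, hy, rfl⟩
      exact ⟨a * x, I.mul_mem_left _ _ hx, y, hy, by rw [mul_assoc]⟩) (by
      rintro _ a ⟨x, hx, y, hy, rfl⟩
      exact ⟨x, hx, y * a, J.mul_mem_right _ _ hy, by rw [mul_assoc]⟩)
  have hz' := (key z).1 hz
  induction hz' using AddSubgroup.closure_induction with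
  | mem w hw => obtain ⟨x, hx, y, hy, rfl⟩ := hw; exact hmul x hx y hy
  | zero => exact h0
  | add x y hx hy ihx ihy =>
    exact hadd x ((key x).2 hx) y ((key y).2 hy) (ihx ((key x).2 hx)) (ihy ((key y).2 hy))
  | neg x hx ihx => exact hneg x ((key x).2 hx) (ihx ((key x).2 hx))

theorem idealMul_le_left (I J : TwoSidedIdeal R) : idealMul I J ≤ I := fun _ hz =>
  idealMul_induction (p := fun z => z ∈ I) (fun _ hx _ _ => I.mul_mem_right _ _ hx) I.zero_mem
    (fun _ _ _ _ hx hy => I.add_mem hx hy) (fun _ _ hx => I.neg_mem hx) hz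

theorem idealMul_le_right (I J : TwoSidedIdeal R) : idealMul I J ≤ J := fun _ hz =>
  idealMul_induction (p := fun z => z ∈ J) (fun _ _ _ hy => J.mul_mem_left _ _ hy) J.zero_mem
    (fun _ _ _ _ hx hy => J.add_mem hx hy) (fun _ _ hx => J.neg_mem hx) hz

theorem exists_ne_zero {I : TwoSidedIdeal R} (hI : I ≠ ⊥) : ∃ x ∈ I, x ≠ 0 := by
  by_contra! h
  refine hI (le_antisymm (fun x hx => ?_) bot_le)
  exact (TwoSidedIdeal.mem_bot R).2 (h x hx)

theorem ne_bot_of_mem {I : TwoSidedIdeal R} {x : R} (hx : x ∈ I) (h0 : x ≠ 0) : I ≠ ⊥ := by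
  rintro rfl
  exact h0 ((TwoSidedIdeal.mem_bot R).1 hx)

variable [IsPrimeRing R]

theorem idealMul_ne_bot {I J : TwoSidedIdeal R} (hI : I ≠ ⊥) (hJ : J ≠ ⊥) :
    idealMul I J ≠ ⊥ := by
  obtain ⟨x, hx, hx0⟩ := exists_ne_zero hI
  obtain ⟨y, hy, hy0⟩ := exists_ne_zero hJ
  obtain ⟨r, hr⟩ : ∃ r : R, x * r * y ≠ 0 := by
    by_contra! h
    exact (IsPrimeRing.eq_zero_or_eq_zero x y h).elim hx0 hy0
  exact ne_bot_of_mem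
    (TwoSidedIdeal.subset_span ⟨x * r, I.mul_mem_right _ _ hx, y, hy, rfl⟩) hr

theorem inf_ne_bot {I J : TwoSidedIdeal R} (hI : I ≠ ⊥) (hJ : J ≠ ⊥) : I ⊓ J ≠ ⊥ := fun h =>
  idealMul_ne_bot hI hJ
    (le_antisymm (h ▸ le_inf (idealMul_le_left I J) (idealMul_le_right I J)) bot_le)

theorem top_ne_bot : (⊤ : TwoSidedIdeal R) ≠ ⊥ := by
  obtain ⟨x, hx⟩ := exists_ne (0 : R)
  exact ne_bot_of_mem (x := x) trivial hx

end Ideals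

/-- A homomorphism of right `R`-modules `I → R` from a nonzero two-sided ideal `I` (called `dom`) of
`R`. It is recorded by a function on all of `R`, of which only the values on `I` matter: two
such homomorphisms are compared below only on ideals inside their domains. -/
structure PartialHom (R : Type*) [NonUnitalRing R] where
  dom : TwoSidedIdeal R
  dom_ne_bot : dom ≠ ⊥
  toFun : R → R
  map_add : ∀ x ∈ dom, ∀ y ∈ dom, toFun (x + y) = toFun x + toFun y
  map_mul : ∀ x ∈ dom, ∀ r : R, toFun (x * r) = toFun x * r

namespace PartialHom

variable {R : Type*} [NonUnitalRing R]

theorem map_zero (f : PartialHom R) : f.toFun 0 = 0 := by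
  have h := f.map_add 0 f.dom.zero_mem 0 f.dom.zero_mem
  simpa using h

theorem map_neg (f : PartialHom R) {x : R} (hx : x ∈ f.dom) : f.toFun (-x) = -f.toFun x := by
  have h := f.map_add x hx (-x) (f.dom.neg_mem hx)
  rw [add_neg_cancel, f.map_zero] at h
  exact (neg_eq_of_add_eq_zero_right h.symm).symm

theorem map_mem_of_mem_idealMul (g : PartialHom R) (I : TwoSidedIdeal R) {z : R}
    (hz : z ∈ idealMul g.dom I) : g.toFun z ∈ I := by
  refine idealMul_induction (p := fun z => g.toFun z ∈ I) ?_ ?_ ?_ ?_ hz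
  · intro x hx y hy
    rw [g.map_mul x hx]
    exact I.mul_mem_left _ _ hy
  · rw [g.map_zero]; exact I.zero_mem
  · intro x hx y hy h1 h2
    rw [g.map_add x (idealMul_le_left _ _ hx) y (idealMul_le_left _ _ hy)]
    exact I.add_mem h1 h2
  · intro x hx h
    rw [g.map_neg (idealMul_le_left _ _ hx)]
    exact I.neg_mem h

theorem map_mem_of_mem_idealMul_of_le (g : PartialHom R) {V : TwoSidedIdeal R} (hV : V ≤ g.dom)
    (I : TwoSidedIdeal R) {z : R} (hz : z ∈ idealMul V I) : g.toFun z ∈ I := by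
  refine g.map_mem_of_mem_idealMul I (TwoSidedIdeal.span_mono ?_ hz)
  rintro _ ⟨x, hx, y, hy, rfl⟩
  exact ⟨x, hV hx, y, hy, rfl⟩

variable [IsPrimeRing R]

/-- Left multiplication by an element of `R`, as a homomorphism of right modules. -/
def lmul (a : R) : PartialHom R where
  dom := ⊤
  dom_ne_bot := top_ne_bot
  toFun x := a * x
  map_add x _ y _ := mul_add a x y
  map_mul x _ r := (mul_assoc a x r).symm

/-- The identity map. -/
def one : PartialHom R where
  dom := ⊤
  dom_ne_bot := top_ne_bot
  toFun x := x
  map_add _ _ _ _ := rfl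
  map_mul _ _ _ := rfl

/-- The sum, defined on the intersection of the domains. -/
def add (f g : PartialHom R) : PartialHom R where
  dom := f.dom ⊓ g.dom
  dom_ne_bot := inf_ne_bot f.dom_ne_bot g.dom_ne_bot
  toFun x := f.toFun x + g.toFun x
  map_add x hx y hy := by
    rw [TwoSidedIdeal.mem_inf] at hx hy
    rw [f.map_add x hx.1 y hy.1, g.map_add x hx.2 y hy.2]; abel
  map_mul x hx r := by
    rw [TwoSidedIdeal.mem_inf] at hx
    rw [f.map_mul x hx.1, g.map_mul x hx.2, add_mul]

/-- The negative. -/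
def neg (f : PartialHom R) : PartialHom R where
  dom := f.dom
  dom_ne_bot := f.dom_ne_bot
  toFun x := -f.toFun x
  map_add x hx y hy := by rw [f.map_add x hx y hy]; abel
  map_mul x hx r := by rw [f.map_mul x hx, neg_mul]

/-- The composite `f ∘ g`, defined on the product of the domains of `g` and `f`. -/
def comp (f g : PartialHom R) : PartialHom R where
  dom := idealMul g.dom f.dom
  dom_ne_bot := idealMul_ne_bot g.dom_ne_bot f.dom_ne_bot
  toFun x := f.toFun (g.toFun x)
  map_add x hx y hy := by
    rw [g.map_add x (idealMul_le_left _ _ hx) y (idealMul_le_left _ _ hy),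
      f.map_add _ (g.map_mem_of_mem_idealMul _ hx) _ (g.map_mem_of_mem_idealMul _ hy)]
  map_mul x hx r := by
    rw [g.map_mul x (idealMul_le_left _ _ hx), f.map_mul _ (g.map_mem_of_mem_idealMul _ hx)]

/-- Two partial homomorphisms are identified when they agree on some nonzero ideal contained in
both domains. -/
instance setoid (R : Type*) [NonUnitalRing R] [IsPrimeRing R] : Setoid (PartialHom R) where
  r f g := ∃ W : TwoSidedIdeal R, W ≠ ⊥ ∧ W ≤ f.dom ∧ W ≤ g.dom ∧ ∀ x ∈ W, f.toFun x = g.toFun x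
  iseqv :=
    { refl := fun f => ⟨f.dom, f.dom_ne_bot, le_rfl, le_rfl, fun _ _ => rfl⟩
      symm := fun ⟨W, h0, h1, h2, h⟩ => ⟨W, h0, h2, h1, fun x hx => (h x hx).symm⟩
      trans := fun ⟨W, h0, h1, h2, h⟩ ⟨V, k0, k1, k2, k⟩ =>
        ⟨W ⊓ V, inf_ne_bot h0 k0, inf_le_left.trans h1, inf_le_right.trans k2, fun x hx => by
          rw [TwoSidedIdeal.mem_inf] at hx
          exact (h x hx.1).trans (k x hx.2)⟩ }

theorem equiv_of_eq {f g : PartialHom R}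
    (h : ∀ x ∈ f.dom, x ∈ g.dom → f.toFun x = g.toFun x) : f ≈ g :=
  ⟨f.dom ⊓ g.dom, inf_ne_bot f.dom_ne_bot g.dom_ne_bot, inf_le_left, inf_le_right, fun x hx => by
    rw [TwoSidedIdeal.mem_inf] at hx
    exact h x hx.1 hx.2⟩

theorem add_equiv {f f' g g' : PartialHom R} (hf : f ≈ f') (hg : g ≈ g') :
    f.add g ≈ f'.add g' := by
  obtain ⟨W, h0, h1, h2, h⟩ := hf
  obtain ⟨V, k0, k1, k2, k⟩ := hg
  refine ⟨W ⊓ V, inf_ne_bot h0 k0, inf_le_inf h1 k1, inf_le_inf h2 k2, fun x hx => ?_⟩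
  rw [TwoSidedIdeal.mem_inf] at hx
  exact congrArg₂ (· + ·) (h x hx.1) (k x hx.2)

theorem neg_equiv {f f' : PartialHom R} (hf : f ≈ f') : f.neg ≈ f'.neg := by
  obtain ⟨W, h0, h1, h2, h⟩ := hf
  exact ⟨W, h0, h1, h2, fun x hx => congrArg (fun y => -y) (h x hx)⟩

theorem comp_equiv {f f' g g' : PartialHom R} (hf : f ≈ f') (hg : g ≈ g') :
    f.comp g ≈ f'.comp g' := by
  obtain ⟨W, h0, h1, h2, h⟩ := hf
  obtain ⟨V, k0, k1, k2, k⟩ := hg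
  refine ⟨idealMul V W, idealMul_ne_bot k0 h0, TwoSidedIdeal.span_mono ?_,
    TwoSidedIdeal.span_mono ?_, fun x hx => ?_⟩
  · rintro _ ⟨x, hx, y, hy, rfl⟩
    exact ⟨x, k1 hx, y, h1 hy, rfl⟩
  · rintro _ ⟨x, hx, y, hy, rfl⟩
    exact ⟨x, k2 hx, y, h2 hy, rfl⟩
  · change f.toFun (g.toFun x) = f'.toFun (g'.toFun x)
    rw [← k x (idealMul_le_left _ _ hx)]
    exact h _ (g.map_mem_of_mem_idealMul_of_le k1 W hx)

end PartialHom

/-- The Martindale right ring of quotients of a prime ring `R`: the direct limit of the groups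
`Hom(I_R, R_R)` over the nonzero two-sided ideals `I` of `R`. -/
def RightQuotient (R : Type*) [NonUnitalRing R] [IsPrimeRing R] : Type _ :=
  Quotient (PartialHom.setoid R)

namespace RightQuotient

variable {R : Type*} [NonUnitalRing R] [IsPrimeRing R]

/-- Addition is induced by pointwise addition. -/
instance : Add (RightQuotient R) where
  add := Quotient.map₂ PartialHom.add fun _ _ hf _ _ hg => PartialHom.add_equiv hf hg

instance : Zero (RightQuotient R) where
  zero := Quotient.mk _ (PartialHom.lmul 0)

instance : Neg (RightQuotient R) where
  neg := Quotient.map PartialHom.neg fun _ _ hf => PartialHom.neg_equiv hf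

/-- Multiplication is induced by composition. -/
instance : Mul (RightQuotient R) where
  mul := Quotient.map₂ PartialHom.comp fun _ _ hf _ _ hg => PartialHom.comp_equiv hf hg

instance : One (RightQuotient R) where
  one := Quotient.mk _ PartialHom.one

instance : Ring (RightQuotient R) where
  nsmul := nsmulRec
  zsmul := zsmulRec
  add_assoc := by
    rintro ⟨f⟩ ⟨g⟩ ⟨h⟩
    exact Quotient.sound (PartialHom.equiv_of_eq fun x _ _ => add_assoc _ _ _)
  zero_add := by
    rintro ⟨f⟩
    refine Quotient.sound (PartialHom.equiv_of_eq fun x _ _ => ?_)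
    change 0 * x + f.toFun x = f.toFun x
    rw [zero_mul, zero_add]
  add_zero := by
    rintro ⟨f⟩
    refine Quotient.sound (PartialHom.equiv_of_eq fun x _ _ => ?_)
    change f.toFun x + 0 * x = f.toFun x
    rw [zero_mul, add_zero]
  add_comm := by
    rintro ⟨f⟩ ⟨g⟩
    exact Quotient.sound (PartialHom.equiv_of_eq fun x _ _ => add_comm _ _)
  neg_add_cancel := by
    rintro ⟨f⟩
    refine Quotient.sound (PartialHom.equiv_of_eq fun x _ _ => ?_)
    change -f.toFun x + f.toFun x = 0 * x
    rw [zero_mul, neg_add_cancel]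
  mul_assoc := by
    rintro ⟨f⟩ ⟨g⟩ ⟨h⟩
    exact Quotient.sound (PartialHom.equiv_of_eq fun x _ _ => rfl)
  one_mul := by
    rintro ⟨f⟩
    exact Quotient.sound (PartialHom.equiv_of_eq fun x _ _ => rfl)
  mul_one := by
    rintro ⟨f⟩
    exact Quotient.sound (PartialHom.equiv_of_eq fun x _ _ => rfl)
  zero_mul := by
    rintro ⟨f⟩
    refine Quotient.sound (PartialHom.equiv_of_eq fun x _ _ => ?_)
    change 0 * f.toFun x = 0 * x
    rw [zero_mul, zero_mul]
  mul_zero := by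
    rintro ⟨f⟩
    refine Quotient.sound (PartialHom.equiv_of_eq fun x _ _ => ?_)
    change f.toFun (0 * x) = 0 * x
    rw [zero_mul, f.map_zero]
  left_distrib := by
    rintro ⟨f⟩ ⟨g⟩ ⟨h⟩
    refine Quotient.sound (PartialHom.equiv_of_eq fun x _ hx => ?_)
    replace hx := (TwoSidedIdeal.mem_inf R).1 hx
    exact f.map_add _ (g.map_mem_of_mem_idealMul _ hx.1) _ (h.map_mem_of_mem_idealMul _ hx.2)
  right_distrib := by
    rintro ⟨f⟩ ⟨g⟩ ⟨h⟩
    exact Quotient.sound (PartialHom.equiv_of_eq fun x _ _ => rfl)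

/-- The canonical map of `R` into its right ring of quotients; `a` acts by left multiplication. -/
def of (R : Type*) [NonUnitalRing R] [IsPrimeRing R] : R →ₙ+* RightQuotient R where
  toFun a := Quotient.mk _ (PartialHom.lmul a)
  map_zero' := rfl
  map_add' a b := Quotient.sound (PartialHom.equiv_of_eq fun x _ _ => add_mul a b x)
  map_mul' a b := Quotient.sound (PartialHom.equiv_of_eq fun x _ _ => mul_assoc a b x)

end RightQuotient

open RightQuotient in
/-- The Martindale symmetric ring of quotients of a prime ring `R`: the elements `q` of the right
ring of quotients for which `J q ⊆ R` for some nonzero two-sided ideal `J` of `R`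
(that `q I ⊆ R` for some nonzero ideal `I` holds for every `q`). -/
def SymmetricQuotient (R : Type*) [NonUnitalRing R] [IsPrimeRing R] :
    Subring (RightQuotient R) where
  carrier := {q | ∃ J : TwoSidedIdeal R, J ≠ ⊥ ∧ ∀ x ∈ J, ∃ y : R, of R x * q = of R y}
  zero_mem' := ⟨⊤, top_ne_bot, fun x _ => ⟨0, by rw [mul_zero, map_zero]⟩⟩
  one_mem' := ⟨⊤, top_ne_bot, fun x _ => ⟨x, mul_one _⟩⟩
  add_mem' := by
    rintro p q ⟨I, hI, h⟩ ⟨J, hJ, k⟩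
    refine ⟨I ⊓ J, inf_ne_bot hI hJ, fun x hx => ?_⟩
    rw [TwoSidedIdeal.mem_inf] at hx
    obtain ⟨y, hy⟩ := h x hx.1
    obtain ⟨z, hz⟩ := k x hx.2
    exact ⟨y + z, by rw [mul_add, hy, hz, map_add]⟩
  neg_mem' := by
    rintro q ⟨J, hJ, k⟩
    refine ⟨J, hJ, fun x hx => ?_⟩
    obtain ⟨z, hz⟩ := k x hx
    exact ⟨-z, by rw [mul_neg, hz, map_neg]⟩
  mul_mem' := by
    rintro p q ⟨I, hI, h⟩ ⟨J, hJ, k⟩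
    refine ⟨idealMul J I, idealMul_ne_bot hJ hI, fun z hz => ?_⟩
    refine idealMul_induction (p := fun z => ∃ y : R, of R z * (p * q) = of R y)
      ?_ ?_ ?_ ?_ hz
    · intro x hx y hy
      obtain ⟨w, hw⟩ := h y hy
      obtain ⟨v, hv⟩ := k (x * w) (J.mul_mem_right _ _ hx)
      exact ⟨v, by rw [← hv, map_mul, map_mul, ← hw]; simp only [mul_assoc]⟩
    · exact ⟨0, by rw [map_zero, zero_mul]⟩
    · rintro x - y - ⟨a, ha⟩ ⟨b, hb⟩
      exact ⟨a + b, by rw [map_add, map_add, add_mul, ha, hb]⟩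
    · rintro x - ⟨a, ha⟩
      exact ⟨-a, by rw [map_neg, map_neg, neg_mul, ha]⟩

/-- The canonical map of `R` into its symmetric ring of quotients. -/
def toSymmetricQuotient (R : Type*) [NonUnitalRing R] [IsPrimeRing R] :
    R →ₙ+* SymmetricQuotient R where
  toFun a := ⟨RightQuotient.of R a, ⊤, top_ne_bot, fun x _ => ⟨x * a, (map_mul _ x a).symm⟩⟩
  map_zero' := Subtype.ext (map_zero _)
  map_add' a b := Subtype.ext (map_add _ a b)
  map_mul' a b := Subtype.ext (map_mul _ a b)

/-- The extended centroid `C` of `R`: the center of the symmetric ring of quotients. -/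
def extendedCentroid (R : Type*) [NonUnitalRing R] [IsPrimeRing R] :
    Subring (SymmetricQuotient R) :=
  Subring.center (SymmetricQuotient R)

variable {R : Type*} [NonUnitalRing R] [IsPrimeRing R]

open scoped Pointwise in
/-- `KC`: the additive subgroup of the symmetric ring of quotients generated by all products of an
element of `K` and an element of the extended centroid `C`. -/
def mulC (K : AddSubgroup R) : AddSubgroup (SymmetricQuotient R) :=
  K.map (toSymmetricQuotient R : R →+ SymmetricQuotient R) * (extendedCentroid R).toAddSubgroup

/-- `Ca + C`, where `C` is the extended centroid of `R`. -/
def affineC (a : R) : AddSubgroup (SymmetricQuotient R) where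
  carrier := {x | ∃ c ∈ extendedCentroid R, ∃ d ∈ extendedCentroid R,
    x = c * toSymmetricQuotient R a + d}
  zero_mem' := ⟨0, zero_mem _, 0, zero_mem _, by simp⟩
  add_mem' := by
    rintro _ _ ⟨c, hc, d, hd, rfl⟩ ⟨c', hc', d', hd', rfl⟩
    exact ⟨c + c', add_mem hc hc', d + d', add_mem hd hd', by rw [add_mul]; abel⟩
  neg_mem' := by
    rintro _ ⟨c, hc, d, hd, rfl⟩
    exact ⟨-c, neg_mem hc, -d, neg_mem hd, by rw [neg_mul]; abel⟩

end Martindale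

/-! Write [x, y] = xy - yx. A Lie ideal V containing xR for some x ≠ 0 contains a nonzero ideal, so
the work is to find such an x in a product of Lie ideals.

The main step (`containsIdeal_mul_of_commutator_ne_zero`) is that KL contains a nonzero ideal as
soon as some k ∈ K and l ∈ L do not commute. If there is no such ideal, elements of L ∩ KL commute
with K and elements of K ∩ KL commute with L; applied to c = [k, l] ∈ K ∩ L this forces c = 0.
Further noncentral factors on either side preserve the presence of a nonzero ideal.

Hence, if the whole product contains no nonzero ideal, consecutive factors commute elementwise. For
a ∈ K_i and b ∈ K_{i+1} this gives [a, [b, r]] = 0 for all r, and for noncentral a this yields b ∈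
Ca + C. So all noncentral elements of all factors span the same Ca + C, and each K_jC is all of it.
Conversely, Ca + C is commutative, so under the exceptional condition the product lies in a
commutative subring; a nonzero ideal inside it would make R commutative. -/

open scoped Pointwise

/-! ### Products of Lie ideals and ideals contained in them -/

section Products

variable {R : Type*} [NonUnitalRing R]

theorem AddSubgroup.mul_mem_mul' {A B : AddSubgroup R} {a b : R} (ha : a ∈ A) (hb : b ∈ B) :
    a * b ∈ A * B :=
  AddSubmonoid.mul_mem_mul (M := A.toAddSubmonoid) (N := B.toAddSubmonoid) ha hb

theorem AddSubgroup.mul_le_iff {A B P : AddSubgroup R} :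
    A * B ≤ P ↔ ∀ a ∈ A, ∀ b ∈ B, a * b ∈ P :=
  AddSubmonoid.mul_le (M := A.toAddSubmonoid) (N := B.toAddSubmonoid) (P := P.toAddSubmonoid)

theorem AddSubgroup.mul_induction_on' {A B : AddSubgroup R} {p : R → Prop} {x : R}
    (hx : x ∈ A * B) (hmul : ∀ a ∈ A, ∀ b ∈ B, p (a * b))
    (hadd : ∀ x y, p x → p y → p (x + y)) : p x :=
  AddSubmonoid.mul_induction_on (M := A.toAddSubmonoid) (N := B.toAddSubmonoid) hx hmul hadd

theorem AddSubgroup.mul_assoc_le (A B D : AddSubgroup R) : A * (B * D) ≤ A * B * D := by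
  refine AddSubgroup.mul_le_iff.2 fun a ha x hx => ?_
  refine AddSubgroup.mul_induction_on' (p := fun x => a * x ∈ A * B * D) hx
    (fun b hb d hd => ?_) (fun x y hx hy => ?_)
  · rw [← mul_assoc]
    exact AddSubgroup.mul_mem_mul' (AddSubgroup.mul_mem_mul' ha hb) hd
  · rw [mul_add]
    exact add_mem hx hy

theorem IsLieIdeal.mul {K L : AddSubgroup R} (hK : IsLieIdeal K) (hL : IsLieIdeal L) :
    IsLieIdeal (K * L) := by
  intro v hv r
  refine AddSubgroup.mul_induction_on' (p := fun v => v * r - r * v ∈ K * L) hv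
    (fun k hk l hl => ?_) (fun x y hx hy => ?_)
  · have : k * l * r - r * (k * l) = k * (l * r - r * l) + (k * r - r * k) * l := by
      noncomm_ring
    rw [this]
    exact add_mem (AddSubgroup.mul_mem_mul' hk (hL l hl r))
      (AddSubgroup.mul_mem_mul' (hK k hk r) hl)
  · have : (x + y) * r - r * (x + y) = (x * r - r * x) + (y * r - r * y) := by noncomm_ring
    rw [this]
    exact add_mem hx hy

theorem IsLieIdeal.lieProd : ∀ {n : ℕ} {K : Fin (n + 1) → AddSubgroup R},
    (∀ j, IsLieIdeal (K j)) → IsLieIdeal (lieProd n K)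
  | 0, _, h => h 0
  | _ + 1, _, h => (IsLieIdeal.lieProd fun i => h i.castSucc).mul (h (Fin.last _))

theorem lieProd_subset_of_forall_subset (S : NonUnitalSubring R) :
    ∀ {n : ℕ} {K : Fin (n + 1) → AddSubgroup R}, (∀ j, K j ≤ S.toAddSubgroup) →
      lieProd n K ≤ S.toAddSubgroup
  | 0, _, h => h 0
  | _ + 1, _, h => AddSubgroup.mul_le_iff.2 fun _ ha _ hb =>
      S.mul_mem (lieProd_subset_of_forall_subset S (fun i => h i.castSucc) ha) (h (Fin.last _) hb)

/-- The additive subgroup `A` contains a nonzero two-sided ideal. -/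
def ContainsIdeal (A : AddSubgroup R) : Prop :=
  ∃ I : TwoSidedIdeal R, I ≠ ⊥ ∧ (I : Set R) ⊆ A

/-- The largest two-sided ideal contained in a Lie ideal. -/
def IsLieIdeal.core {V : AddSubgroup R} (hV : IsLieIdeal V) : TwoSidedIdeal R :=
  .mk' {x | x ∈ V ∧ ∀ d, x * d ∈ V} ⟨V.zero_mem, fun d => by rw [zero_mul]; exact V.zero_mem⟩
    (fun hx hy => ⟨V.add_mem hx.1 hy.1, fun d => by
      rw [add_mul]; exact V.add_mem (hx.2 d) (hy.2 d)⟩)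
    (fun hx => ⟨V.neg_mem hx.1, fun d => by rw [neg_mul]; exact V.neg_mem (hx.2 d)⟩)
    -- Left absorption follows from the Lie property: rx = xr - [x, r] and rxd = xdr - [xd, r].
    (fun {r x} hx => ⟨by
      have := V.sub_mem (hx.2 r) (hV x hx.1 r)
      rwa [sub_sub_cancel] at this, fun d => by
      have := V.sub_mem (hx.2 (d * r)) (hV _ (hx.2 d) r)
      rw [← mul_assoc, sub_sub_cancel] at this
      rwa [mul_assoc]⟩)
    (fun {x r} hx => ⟨hx.2 r, fun d => by rw [mul_assoc]; exact hx.2 _⟩)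

theorem IsLieIdeal.mem_core {V : AddSubgroup R} (hV : IsLieIdeal V) {x : R} :
    x ∈ hV.core ↔ x ∈ V ∧ ∀ d, x * d ∈ V :=
  TwoSidedIdeal.mem_mk' _ _ _ _ _ _ _

end Products

/-! ### Products of two noncommuting Lie ideals in a prime ring -/

section Prime

variable {R : Type*} [NonUnitalRing R] [IsPrimeRing R]

theorem IsPrimeRing.right_eq_zero {a b : R} (ha : a ≠ 0) (h : ∀ r, a * r * b = 0) : b = 0 :=
  (IsPrimeRing.eq_zero_or_eq_zero a b h).resolve_left ha

theorem IsPrimeRing.left_eq_zero {a b : R} (hb : b ≠ 0) (h : ∀ r, a * r * b = 0) : a = 0 :=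
  (IsPrimeRing.eq_zero_or_eq_zero a b h).resolve_right hb

theorem IsPrimeRing.eq_zero_of_mul_right {a : R} (h : ∀ r, a * r = 0) : a = 0 := by
  obtain ⟨x, hx⟩ := exists_ne (0 : R)
  exact IsPrimeRing.left_eq_zero hx fun r => by rw [h, zero_mul]

theorem exists_commutator_ne_zero {R : Type*} [NonUnitalRing R] {c : R} (hc : c ∉ Set.center R) : ∃ r, c * r - r * c ≠ 0 := by
  by_contra! h
  exact hc (Semigroup.mem_center_iff.2 fun r => (sub_eq_zero.1 (h r)).symm)

/-- Since [c, sr] - s[c, r] = [c, s]r, the element x is annihilated by [c, s]R, and primeness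
applies. -/
theorem eq_zero_of_commutator_mul {c x : R} (hc : c ∉ Set.center R)
    (h : ∀ r, (c * r - r * c) * x = 0) : x = 0 := by
  obtain ⟨s, hs⟩ := exists_commutator_ne_zero hc
  refine IsPrimeRing.right_eq_zero hs fun r => ?_
  linear_combination (norm := noncomm_ring) h (s * r) - s * h r

theorem eq_zero_of_mul_commutator {c x : R} (hc : c ∉ Set.center R)
    (h : ∀ r, x * (c * r - r * c) = 0) : x = 0 := by
  obtain ⟨s, hs⟩ := exists_commutator_ne_zero hc
  refine IsPrimeRing.left_eq_zero hs fun r => ?_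
  linear_combination (norm := noncomm_ring) h (r * s) - h r * s

theorem eq_zero_of_mul_of_mem_center {z x : R} (hz : z ∈ Set.center R) (hz0 : z ≠ 0)
    (h : z * x = 0) : x = 0 := by
  refine IsPrimeRing.right_eq_zero hz0 fun r => ?_
  rw [← Semigroup.mem_center_iff.1 hz r, mul_assoc, h, mul_zero]

theorem eq_zero_of_add_self_ne_zero {x y : R} (hx : x + x ≠ 0) (hy : y + y = 0) : y = 0 := by
  refine IsPrimeRing.right_eq_zero hx fun r => ?_
  linear_combination (norm := noncomm_ring) x * r * hy

theorem containsIdeal_of_mul_mem {V : AddSubgroup R} (hV : IsLieIdeal V) {x : R} (hx : x ≠ 0)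
    (h : ∀ d, x * d ∈ V) : ContainsIdeal V := by
  obtain ⟨r, hr⟩ : ∃ r, x * r ≠ 0 := by
    by_contra! h0
    exact hx (IsPrimeRing.eq_zero_of_mul_right h0)
  refine ⟨hV.core, Martindale.ne_bot_of_mem (x := x * r) (hV.mem_core.2 ⟨h r, fun d => ?_⟩) hr,
    fun y hy => (hV.mem_core.1 hy).1⟩
  rw [mul_assoc]
  exact h _

/-- The identity [k, c]d = k[c, d] - [c, kd] puts [k, c]R inside KL. -/
theorem commutator_eq_zero_of_mem_mul_right {K L : AddSubgroup R} (hK : IsLieIdeal K)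
    (hL : IsLieIdeal L) (hV : ¬ ContainsIdeal (K * L)) {k c : R} (hk : k ∈ K) (hc : c ∈ L)
    (hcV : c ∈ K * L) : k * c - c * k = 0 := by
  by_contra h
  refine hV (containsIdeal_of_mul_mem (hK.mul hL) h fun d => ?_)
  have : (k * c - c * k) * d = k * (c * d - d * c) - (c * (k * d) - k * d * c) := by noncomm_ring
  rw [this]
  exact sub_mem (AddSubgroup.mul_mem_mul' hk (hL c hc d)) (hK.mul hL c hcV _)

theorem commutator_eq_zero_of_mem_mul_left {K L : AddSubgroup R} (hK : IsLieIdeal K)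
    (hL : IsLieIdeal L) (hV : ¬ ContainsIdeal (K * L)) {c l : R} (hl : l ∈ L) (hc : c ∈ K)
    (hcV : c ∈ K * L) : c * l - l * c = 0 := by
  by_contra h
  refine hV (containsIdeal_of_mul_mem (hK.mul hL) h fun d => ?_)
  have : (c * l - l * c) * d = ((c * l - l * c) * d - d * (c * l - l * c)) -
      (c * d - d * c) * l + (c * (d * l) - d * l * c) := by noncomm_ring
  rw [this]
  exact add_mem (sub_mem (hK.mul hL _ (hK.mul hL c hcV l) d)
    (AddSubgroup.mul_mem_mul' (hK c hc d) hl)) (hK.mul hL c hcV _)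

/-- If `[c, [c, r]] l + [c, r] [c, l] = 0` for all `r` and all `l` in a Lie ideal containing `c`,
then `[c, [c, r]] = 0` for all `r`. -/
theorem commutator_commutator_eq_zero {L : AddSubgroup R} (hL : IsLieIdeal L) {c : R} (hc : c ∈ L)
    (h : ∀ r, ∀ l ∈ L, (c * (c * r - r * c) - (c * r - r * c) * c) * l +
      (c * r - r * c) * (c * l - l * c) = 0) (s : R) :
    c * (c * s - s * c) - (c * s - s * c) * c = 0 := by
  by_cases hc0 : c = 0
  · simp [hc0]
  by_cases hcen : c ∈ Set.center R
  · simp [Semigroup.mem_center_iff.1 hcen]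
  have h1 : ∀ r, (c * (c * r - r * c) - (c * r - r * c) * c) * c = 0 := fun r => by
    linear_combination (norm := noncomm_ring) h r c hc
  -- With δ = [c, ·], `h1` says δ²(r)c = 0. In characteristic 2 the map δ² is a derivation, so
  -- δ²(s)Rc = 0. Otherwise R has no 2-torsion, and the hypotheses turn out to be contradictory.
  by_cases h2 : ∀ x : R, x + x = 0
  · refine IsPrimeRing.left_eq_zero hc0 fun r => ?_
    linear_combination (norm := noncomm_ring) h1 (s * r) - s * h1 r -
      h2 ((c * s - s * c) * (c * r - r * c) * c)
  push Not at h2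
  obtain ⟨x, hx⟩ := h2
  have h3 : ∀ r, c * (c * r - r * c) * c = 0 := by
    intro r
    refine eq_zero_of_commutator_mul hcen fun t => eq_zero_of_add_self_ne_zero hx ?_
    have h4 : (c * t - t * c) * (c * (c * r - r * c)) * c +
        (c * t - t * c) * (c * (c * r - r * c)) * c = 0 := by
      linear_combination (norm := noncomm_ring) h1 (t * (c * r)) - t * c * h1 r - h1 t * r * c
    linear_combination (norm := noncomm_ring) h4
  have h5 : c * c = 0 := by
    have h6 : ∀ r, (c * r - r * c) * (c * c) = 0 := fun r => by
      linear_combination (norm := noncomm_ring) h3 r - h1 r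
    exact eq_zero_of_commutator_mul hcen h6
  -- As c² = 0, multiplying `h r l` by c on the left leaves crclc = 0.
  have h7 : ∀ l ∈ L, c * l * c = 0 := fun l hl => by
    refine IsPrimeRing.right_eq_zero hc0 fun r => ?_
    linear_combination (norm := skip) c * h r l hl
    simp only [mul_sub, sub_mul, mul_add, mul_assoc, ← mul_assoc c c, h5, zero_mul, mul_zero]
    abel
  -- This is `h7` for l = [[c, r], t]: the product (r, t) ↦ rct is anticommutative between outer
  -- factors c.
  have h8 : ∀ r t, c * r * c * t * c = -(c * t * c * r * c) := fun r t => by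
    have := h7 _ (hL _ (hL c hc r) t)
    linear_combination (norm := skip) -this
    simp only [mul_sub, sub_mul, mul_assoc, ← mul_assoc c c, h5, zero_mul, mul_zero]
    abel
  exfalso
  refine hc0 (IsPrimeRing.eq_zero_of_mul_right fun r => ?_)
  -- Moving r past tcu in one swap gives sign -1; moving it past t and then u gives +1.
  have h9 : ∀ r t u, c * r * c * t * c * u * c = 0 := fun r t u => by
    refine eq_zero_of_add_self_ne_zero hx ?_
    have e1 := h8 r (t * c * u)
    have e2 := h8 r t
    have e3 := h8 r u
    linear_combination (norm := noncomm_ring) e1 + e2 * u * c - c * t * e3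
  have h10 : ∀ r, c * r * c = 0 := fun r =>
    IsPrimeRing.right_eq_zero hc0 fun t => IsPrimeRing.right_eq_zero hc0 fun u => by
      linear_combination (norm := noncomm_ring) h9 u t r
  rw [IsPrimeRing.right_eq_zero hc0 h10, zero_mul]

/-- Suppose KL contains no nonzero ideal. If c = [k, l] is central, then [kl, l] = cl lies in L ∩
KL, so it commutes with k and c² = 0. If c is not central, it commutes with KL, hence with L and
with k, and then c[c, s] = 0 for all s. -/
theorem containsIdeal_mul_of_commutator_ne_zero {K L : AddSubgroup R} (hK : IsLieIdeal K)
    (hL : IsLieIdeal L) {k l : R} (hk : k ∈ K) (hl : l ∈ L) (hkl : k * l - l * k ≠ 0) :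
    ContainsIdeal (K * L) := by
  by_contra hV
  have hVL := hK.mul hL
  obtain ⟨c, hc⟩ : ∃ c, c = k * l - l * k := ⟨_, rfl⟩
  rw [← hc] at hkl
  have hcK : c ∈ K := hc ▸ hK k hk l
  have hcL : c ∈ L := by
    rw [hc, ← neg_sub]
    exact neg_mem (hL l hl k)
  by_cases hcen : c ∈ Set.center R
  · have hcen' := Semigroup.mem_center_iff.1 hcen
    have e : k * l * l - l * (k * l) = c * l := by rw [hc]; noncomm_ring
    have h1 : k * (c * l) - c * l * k = 0 := by
      refine commutator_eq_zero_of_mem_mul_right hK hL hV hk ?_ ?_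
      · rw [← e, ← neg_sub]
        exact neg_mem (hL l hl _)
      · rw [← e]
        exact hVL _ (AddSubgroup.mul_mem_mul' hk hl) l
    refine hkl (eq_zero_of_mul_of_mem_center hcen hkl ?_)
    rw [← mul_assoc, hcen' k, mul_assoc, mul_assoc, ← mul_sub, ← hc] at h1
    exact h1
  -- By the Jacobi identity, since [l, v] ∈ L ∩ KL commutes with k and [k, v] ∈ K ∩ KL commutes with
  -- l.
  have hcV : ∀ v ∈ K * L, c * v - v * c = 0 := by
    intro v hv
    have e1 : l * v - v * l ∈ L := hL l hl v
    have e2 : l * v - v * l ∈ K * L := by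
      rw [← neg_sub]
      exact neg_mem (hVL v hv l)
    have e3 := commutator_eq_zero_of_mem_mul_right hK hL hV hk e1 e2
    have e4 : k * v - v * k ∈ K := hK k hk v
    have e5 : k * v - v * k ∈ K * L := by
      rw [← neg_sub]
      exact neg_mem (hVL v hv k)
    have e6 := commutator_eq_zero_of_mem_mul_left hK hL hV hl e4 e5
    rw [hc]
    linear_combination (norm := noncomm_ring) e3 + e6
  have hd : ∀ r, ∀ l ∈ L, (c * (c * r - r * c) - (c * r - r * c) * c) * l +
      (c * r - r * c) * (c * l - l * c) = 0 := fun r l hl => by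
    linear_combination (norm := noncomm_ring)
      hcV _ (AddSubgroup.mul_mem_mul' (hK c hcK r) hl)
  have hd2 := commutator_commutator_eq_zero hL hcL hd
  have hcl : ∀ l ∈ L, c * l - l * c = 0 := fun l hl =>
    eq_zero_of_commutator_mul hcen fun r => by
      have := hd r l hl
      rwa [hd2, zero_mul, zero_add] at this
  have hck : c * k - k * c = 0 :=
    eq_zero_of_mul_commutator hcen fun r => by
      have := hcV _ (AddSubgroup.mul_mem_mul' hk (hL c hcL r))
      linear_combination (norm := noncomm_ring) this - k * hd2 r
  refine hkl (eq_zero_of_mul_commutator hcen fun s => ?_)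
  -- Jacobi again: c commutes with l and [l, r]. Taking ks for r, where [c, ks] = k[c, s], then
  -- gives [l, k][c, s] = 0.
  have hlc : ∀ r, l * (c * r - r * c) - (c * r - r * c) * l = 0 := fun r => by
    have e1 := hcl _ (hL l hl r)
    have e2 := hcl l hl
    linear_combination (norm := noncomm_ring) e1 - e2 * r + r * e2
  have e3 := hlc (k * s)
  have e4 : (k * l - l * k) * (c * s - s * c) = 0 := by
    linear_combination (norm := noncomm_ring)
      -e3 + k * hlc s + l * hck * s - hck * s * l
  rwa [← hc] at e4

end Prime

/-! ### Products of several Lie ideals -/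

section PrimeProducts

variable {R : Type*} [NonUnitalRing R] [IsPrimeRing R]

theorem exists_mul_ne_zero {L : AddSubgroup R} (hL : IsLieIdeal L) (hnc : ¬ IsCentral L) {a : R}
    (ha : a ≠ 0) : ∃ l ∈ L, a * l ≠ 0 := by
  by_contra! h
  refine hnc fun l hl => ?_
  have : l = 0 := IsPrimeRing.right_eq_zero ha fun r => by
    linear_combination (norm := noncomm_ring) h l hl * r - h _ (hL l hl r)
  rw [this]
  exact Set.zero_mem_center

theorem ContainsIdeal.mono {R : Type*} [NonUnitalRing R] {A B : AddSubgroup R} (h : A ≤ B) : ContainsIdeal A → ContainsIdeal B :=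
  fun ⟨I, hI, hIA⟩ => ⟨I, hI, hIA.trans h⟩

/-- For y in the ideal and l ∈ L, the identity yld = y[l, d] + (yd)l puts ylR inside AL. -/
theorem ContainsIdeal.mul_right {A L : AddSubgroup R} (hA : IsLieIdeal A) (hL : IsLieIdeal L)
    (hnc : ¬ IsCentral L) : ContainsIdeal A → ContainsIdeal (A * L) := by
  rintro ⟨I, hI, hIA⟩
  obtain ⟨y, hy, hy0⟩ := Martindale.exists_ne_zero hI
  obtain ⟨l, hl, hl0⟩ := exists_mul_ne_zero hL hnc hy0
  refine containsIdeal_of_mul_mem (hA.mul hL) hl0 fun d => ?_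
  have : y * l * d = y * (l * d - d * l) + y * d * l := by noncomm_ring
  rw [this]
  exact add_mem (AddSubgroup.mul_mem_mul' (hIA hy) (hL l hl d))
    (AddSubgroup.mul_mem_mul' (hIA (I.mul_mem_right _ _ hy)) hl)

theorem ContainsIdeal.mul_left {A B : AddSubgroup R} (hA : IsLieIdeal A) (hB : IsLieIdeal B)
    {a : R} (ha : a ∈ A) (ha0 : a ≠ 0) : ContainsIdeal B → ContainsIdeal (A * B) := by
  rintro ⟨I, hI, hIB⟩
  obtain ⟨y, hy, hy0⟩ := Martindale.exists_ne_zero hI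
  obtain ⟨r, hr⟩ : ∃ r, a * r * y ≠ 0 := by
    by_contra! h
    exact hy0 (IsPrimeRing.right_eq_zero ha0 h)
  refine containsIdeal_of_mul_mem (hA.mul hB) hr fun d => ?_
  rw [mul_assoc, mul_assoc]
  exact AddSubgroup.mul_mem_mul' ha (hIB (I.mul_mem_left _ _ (I.mul_mem_right _ _ hy)))

theorem exists_mem_lieProd_ne_zero : ∀ {n : ℕ} {K : Fin (n + 1) → AddSubgroup R},
    (∀ j, IsLieIdeal (K j)) → (∀ j, ¬ IsCentral (K j)) → ∃ a ∈ lieProd n K, a ≠ 0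
  | 0, K, _, hnc => by
    by_contra! h
    refine hnc 0 fun a ha => ?_
    rw [h a ha]
    exact Set.zero_mem_center
  | n + 1, K, hLie, hnc => by
    obtain ⟨a, ha, ha0⟩ := exists_mem_lieProd_ne_zero (fun i => hLie i.castSucc)
      (fun i => hnc i.castSucc)
    obtain ⟨l, hl, hl0⟩ := exists_mul_ne_zero (hLie (Fin.last _)) (hnc (Fin.last _)) ha0
    exact ⟨_, AddSubgroup.mul_mem_mul' ha hl, hl0⟩

/-- A product of noncentral Lie ideals, two consecutive ones of which do not commute, contains a
nonzero ideal. -/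
theorem containsIdeal_lieProd : ∀ {n : ℕ} {K : Fin (n + 1) → AddSubgroup R},
    (∀ j, IsLieIdeal (K j)) → (∀ j, ¬ IsCentral (K j)) → ∀ i : Fin n,
    ∀ k ∈ K i.castSucc, ∀ l ∈ K i.succ, k * l - l * k ≠ 0 → ContainsIdeal (lieProd n K)
  | 0, _, _, _, i => i.elim0
  | n + 1, K, hLie, hnc, i => by
    induction i using Fin.lastCases with
    | last =>
      intro k hk l hl hkl
      have hI := containsIdeal_mul_of_commutator_ne_zero (hLie _) (hLie _) hk hl hkl
      cases n with
      | zero => exact hI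
      | succ m =>
        obtain ⟨a, ha, ha0⟩ := exists_mem_lieProd_ne_zero
          (fun i : Fin (m + 1) => hLie i.castSucc.castSucc) (fun i => hnc i.castSucc.castSucc)
        exact (hI.mul_left (IsLieIdeal.lieProd fun i => hLie i.castSucc.castSucc)
          ((hLie _).mul (hLie _)) ha ha0).mono (AddSubgroup.mul_assoc_le _ _ _)
    | cast j =>
      intro k hk l hl hkl
      exact (containsIdeal_lieProd (fun i => hLie i.castSucc) (fun i => hnc i.castSucc) j
        k hk l hl hkl).mul_right (IsLieIdeal.lieProd fun i => hLie i.castSucc) (hLie _) (hnc _)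

theorem mem_center_of_commutative_ideal {I : TwoSidedIdeal R} (hI : I ≠ ⊥)
    (h : ∀ x ∈ I, ∀ y ∈ I, x * y = y * x) (r : R) : r ∈ Set.center R := by
  -- The ideal is first shown to be central, via xt[r, y] = 0 for y in it; centrality of the ideal
  -- then passes to R.
  obtain ⟨x, hx, hx0⟩ := Martindale.exists_ne_zero hI
  have h1 : ∀ y ∈ I, ∀ r, r * y - y * r = 0 := fun y hy r =>
    IsPrimeRing.right_eq_zero hx0 fun t => by
      have e1 := h _ (I.mul_mem_right _ (t * r) hx) y hy
      have e2 := h _ (I.mul_mem_right _ t hx) y hy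
      linear_combination (norm := noncomm_ring) e1 - e2 * r
  refine Semigroup.mem_center_iff.2 fun s => sub_eq_zero.1 ?_
  refine IsPrimeRing.left_eq_zero hx0 fun t => ?_
  have e1 := h1 _ (I.mul_mem_left t x hx)
  have e2 := h1 _ (I.mul_mem_right _ r (I.mul_mem_left t x hx)) s
  linear_combination (norm := noncomm_ring) s * e1 r + e2 - e1 (r * s)

theorem not_containsIdeal_lieProd {n : ℕ} {K : Fin (n + 1) → AddSubgroup R}
    (hnc : ¬ IsCentral (K 0))
    (h : ∀ i j, ∀ x ∈ K i, ∀ y ∈ K j, x * y = y * x) : ¬ ContainsIdeal (lieProd n K) := by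
  rintro ⟨I, hI, hIK⟩
  have hcomm := NonUnitalSubring.isMulCommutative_closure (s := ⋃ j, (K j : Set R)) (by
    simp only [Set.mem_iUnion]
    rintro x ⟨i, hx⟩ y ⟨j, hy⟩
    exact h i j x hx y hy)
  have hle := lieProd_subset_of_forall_subset (NonUnitalSubring.closure (⋃ j, (K j : Set R)))
    (K := K) fun j x hx => NonUnitalSubring.subset_closure (Set.mem_iUnion.2 ⟨j, hx⟩)
  refine hnc fun a _ => mem_center_of_commutative_ideal hI (fun x hx y hy => ?_) a
  exact congrArg Subtype.val (hcomm.is_comm.comm ⟨x, hle (hIK hx)⟩ ⟨y, hle (hIK hy)⟩)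

end PrimeProducts

/-! ### The symmetric quotient ring and its extended centroid -/

namespace Martindale

variable {R : Type*} [NonUnitalRing R] [IsPrimeRing R]

theorem RightQuotient.of_injective : Function.Injective (RightQuotient.of R) := by
  intro a b h
  obtain ⟨W, hW, -, -, hab⟩ := Quotient.exact h
  obtain ⟨x, hx, hx0⟩ := exists_ne_zero hW
  refine sub_eq_zero.1 (IsPrimeRing.left_eq_zero hx0 fun r => ?_)
  have e : a * (r * x) = b * (r * x) := hab _ (W.mul_mem_left _ _ hx)
  rw [mul_assoc, sub_mul, e, sub_self]

/-- The class of a partial homomorphism in the right ring of quotients. -/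
def RightQuotient.mk (f : PartialHom R) : RightQuotient R :=
  Quotient.mk _ f

theorem RightQuotient.mk_mul_of (f : PartialHom R) {x : R} (hx : x ∈ f.dom) :
    RightQuotient.mk f * RightQuotient.of R x = RightQuotient.of R (f.toFun x) :=
  Quotient.sound (PartialHom.equiv_of_eq fun z _ _ => f.map_mul x hx z)

theorem RightQuotient.eq_zero_of_mul_of {q : RightQuotient R} {I : TwoSidedIdeal R} (hI : I ≠ ⊥)
    (h : ∀ x ∈ I, q * RightQuotient.of R x = 0) : q = 0 := by
  induction q using Quotient.inductionOn with
  | h f =>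
    refine Quotient.sound ⟨f.dom ⊓ I, inf_ne_bot f.dom_ne_bot hI, inf_le_left, le_top,
      fun x hx => ?_⟩
    rw [TwoSidedIdeal.mem_inf] at hx
    have e : RightQuotient.mk f * RightQuotient.of R x = 0 := h x hx.2
    rw [RightQuotient.mk_mul_of f hx.1, ← map_zero (RightQuotient.of R)] at e
    rw [RightQuotient.of_injective e]
    exact (zero_mul x).symm

theorem toSymmetricQuotient_injective : Function.Injective (toSymmetricQuotient R) :=
  fun _ _ h => RightQuotient.of_injective (congrArg Subtype.val h)

theorem SymmetricQuotient.eq_zero_of_mul {q : SymmetricQuotient R} {I : TwoSidedIdeal R}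
    (hI : I ≠ ⊥) (h : ∀ x ∈ I, q * toSymmetricQuotient R x = 0) : q = 0 :=
  Subtype.ext (RightQuotient.eq_zero_of_mul_of hI fun x hx => congrArg Subtype.val (h x hx))

theorem SymmetricQuotient.exists_ideal_mul (q : SymmetricQuotient R) :
    ∃ I : TwoSidedIdeal R, I ≠ ⊥ ∧
      ∀ x ∈ I, ∃ y, q * toSymmetricQuotient R x = toSymmetricQuotient R y := by
  obtain ⟨q, hq⟩ := q
  induction q using Quotient.inductionOn with
  | h f => exact ⟨f.dom, f.dom_ne_bot, fun x hx =>
      ⟨f.toFun x, Subtype.ext (RightQuotient.mk_mul_of f hx)⟩⟩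

theorem mul_comm_of_mem_extendedCentroid {c : SymmetricQuotient R} (hc : c ∈ extendedCentroid R)
    (q : SymmetricQuotient R) : q * c = c * q :=
  Subring.mem_center_iff.1 hc q

/-- Given p, choose I ≠ 0 with pI ⊆ R. For x ∈ I both x and px lie in R, so pqx = pxq = qpx, and pq
- qp annihilates I. -/
theorem mem_extendedCentroid_of_commute {q : SymmetricQuotient R}
    (h : ∀ r, q * toSymmetricQuotient R r = toSymmetricQuotient R r * q) :
    q ∈ extendedCentroid R := by
  refine Subring.mem_center_iff.2 fun p => sub_eq_zero.1 ?_
  obtain ⟨I, hI, hp⟩ := SymmetricQuotient.exists_ideal_mul p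
  refine SymmetricQuotient.eq_zero_of_mul hI fun x hx => ?_
  obtain ⟨y, hy⟩ := hp x hx
  rw [sub_mul, mul_assoc, h, ← mul_assoc, hy, mul_assoc, hy, h, sub_self]

/-- A subbimodule of `R × R` that is the graph of a nonzero partial map is, on its domain, the
multiplication by an element of the extended centroid. -/
theorem exists_mem_extendedCentroid_of_graph (G : AddSubgroup (R × R))
    (hl : ∀ r x y, (x, y) ∈ G → (r * x, r * y) ∈ G)
    (hr : ∀ r x y, (x, y) ∈ G → (x * r, y * r) ∈ G) (hG : ∀ y, (0, y) ∈ G → y = 0)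
    {x₀ y₀ : R} (hxy : (x₀, y₀) ∈ G) (hx₀ : x₀ ≠ 0) :
    ∃ c ∈ extendedCentroid R, ∀ x y, (x, y) ∈ G →
      c * toSymmetricQuotient R x = toSymmetricQuotient R y := by
  classical
  let I : TwoSidedIdeal R := .mk' {x | ∃ y, (x, y) ∈ G} ⟨0, G.zero_mem⟩
    (fun ⟨y, hy⟩ ⟨z, hz⟩ => ⟨y + z, G.add_mem hy hz⟩) (fun ⟨y, hy⟩ => ⟨-y, G.neg_mem hy⟩)
    (fun {r _} ⟨y, hy⟩ => ⟨r * y, hl r _ y hy⟩) (fun {_ r} ⟨y, hy⟩ => ⟨y * r, hr r _ y hy⟩)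
  have hI : ∀ x, x ∈ I ↔ ∃ y, (x, y) ∈ G := TwoSidedIdeal.mem_mk' _ _ _ _ _ _
  let f : R → R := fun x => if h : ∃ y, (x, y) ∈ G then h.choose else 0
  have hf : ∀ x y, (x, y) ∈ G → f x = y := by
    intro x y h
    have hx : ∃ y, (x, y) ∈ G := ⟨y, h⟩
    have e : f x = hx.choose := dif_pos hx
    have := G.sub_mem hx.choose_spec h
    rw [Prod.mk_sub_mk, sub_self] at this
    rw [e]
    exact sub_eq_zero.1 (hG _ this)
  let F : PartialHom R :=
    { dom := I
      dom_ne_bot := ne_bot_of_mem ((hI x₀).2 ⟨y₀, hxy⟩) hx₀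
      toFun := f
      map_add := fun x hx y hy => by
        obtain ⟨u, hu⟩ := (hI x).1 hx
        obtain ⟨v, hv⟩ := (hI y).1 hy
        rw [hf x u hu, hf y v hv]
        exact hf _ _ (G.add_mem hu hv)
      map_mul := fun x hx r => by
        obtain ⟨u, hu⟩ := (hI x).1 hx
        rw [hf x u hu]
        exact hf _ _ (hr _ _ _ hu) }
  -- This is where the left module structure enters: xf(z) = f(xz) = f(x)z. It makes the class of
  -- `F` symmetric.
  have hmul : ∀ x y, (x, y) ∈ G →
      RightQuotient.of R x * RightQuotient.mk F = RightQuotient.of R y :=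
    fun x y h => Quotient.sound (PartialHom.equiv_of_eq fun z hz _ => by
      replace hz : z ∈ I := idealMul_le_left I _ hz
      obtain ⟨w, hw⟩ := (hI z).1 hz
      change x * f z = y * z
      rw [hf z w hw, ← hf _ _ (hl x _ _ hw), ← hf _ _ (hr z _ _ h)])
  let c : SymmetricQuotient R := ⟨RightQuotient.mk F, I, F.dom_ne_bot, fun x hx => by
    obtain ⟨y, hy⟩ := (hI x).1 hx
    exact ⟨y, hmul x y hy⟩⟩
  have hc : ∀ x y, (x, y) ∈ G → c * toSymmetricQuotient R x = toSymmetricQuotient R y :=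
    fun x y h => Subtype.ext (by
      have := RightQuotient.mk_mul_of F ((hI x).2 ⟨y, h⟩)
      rw [show F.toFun x = y from hf x y h] at this
      exact this)
  refine ⟨c, mem_extendedCentroid_of_commute fun r => sub_eq_zero.1 ?_, hc⟩
  refine SymmetricQuotient.eq_zero_of_mul F.dom_ne_bot fun x hx => ?_
  obtain ⟨y, hy⟩ := (hI x).1 hx
  rw [sub_mul, mul_assoc, mul_assoc, ← map_mul, hc _ _ (hl r _ _ hy), hc _ _ hy, map_mul, sub_self]

theorem mul_toSymmetricQuotient_ne_zero {c : SymmetricQuotient R} (hc : c ∈ extendedCentroid R)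
    (hc0 : c ≠ 0) {x : R} (hx : x ≠ 0) : c * toSymmetricQuotient R x ≠ 0 := by
  intro h
  obtain ⟨I, hI, hcI⟩ := SymmetricQuotient.exists_ideal_mul c
  refine hc0 (SymmetricQuotient.eq_zero_of_mul hI fun z hz => ?_)
  obtain ⟨y, hy⟩ := hcI z hz
  have : y = 0 := IsPrimeRing.left_eq_zero hx fun t => toSymmetricQuotient_injective (by
    rw [map_mul, map_mul, ← hy, map_zero, mul_assoc, mul_assoc, ← mul_assoc,
      ← mul_comm_of_mem_extendedCentroid hc, mul_assoc, ← mul_assoc c,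
      ← mul_comm_of_mem_extendedCentroid hc, mul_assoc, h, mul_zero, mul_zero])
  rw [hy, this, map_zero]

theorem exists_mul_eq_one_of_mem_extendedCentroid {c : SymmetricQuotient R}
    (hc : c ∈ extendedCentroid R) (hc0 : c ≠ 0) : ∃ d ∈ extendedCentroid R, c * d = 1 := by
  -- The graph of division by c, restricted to R.
  let G : AddSubgroup (R × R) :=
    { carrier := {p | toSymmetricQuotient R p.1 = c * toSymmetricQuotient R p.2}
      zero_mem' := by simp
      add_mem' := fun {p q} hp hq => by
        simp only [Set.mem_ofPred_eq, Prod.fst_add, Prod.snd_add, map_add, mul_add] at *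
        rw [hp, hq]
      neg_mem' := fun {p} hp => by
        simp only [Set.mem_ofPred_eq, Prod.fst_neg, Prod.snd_neg, map_neg, mul_neg] at *
        rw [hp] }
  have hmem : ∀ x y, (x, y) ∈ G ↔ toSymmetricQuotient R x = c * toSymmetricQuotient R y :=
    fun x y => Iff.rfl
  obtain ⟨I, hI, hcI⟩ := SymmetricQuotient.exists_ideal_mul c
  obtain ⟨x, hx, hx0⟩ := exists_ne_zero hI
  obtain ⟨y, hy⟩ := hcI x hx
  have hy0 : y ≠ 0 := by
    rintro rfl
    rw [map_zero] at hy
    exact mul_toSymmetricQuotient_ne_zero hc hc0 hx0 hy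
  have hyx : (y, x) ∈ G := (hmem y x).2 hy.symm
  obtain ⟨d, hd, hdG⟩ := exists_mem_extendedCentroid_of_graph G
    (fun r x y h => by
      rw [hmem] at *
      rw [map_mul, map_mul, h, ← mul_assoc, ← mul_assoc, mul_comm_of_mem_extendedCentroid hc])
    (fun r x y h => by
      rw [hmem] at *
      rw [map_mul, map_mul, h, mul_assoc])
    (fun y h => by
      rw [hmem, map_zero] at h
      by_contra hy
      exact mul_toSymmetricQuotient_ne_zero hc hc0 hy h.symm) hyx hy0
  refine ⟨d, hd, sub_eq_zero.1 (by_contra fun h => ?_)⟩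
  refine mul_toSymmetricQuotient_ne_zero (sub_mem (mul_mem hc hd) (one_mem _)) h hy0 ?_
  rw [sub_mul, mul_assoc, hdG _ _ hyx, one_mul, hy, sub_self]

/-! ### Commuting Lie ideals and the subspace Ca + C -/

theorem mem_affineC {a : R} {x : SymmetricQuotient R} : x ∈ affineC a ↔
    ∃ c ∈ extendedCentroid R, ∃ d ∈ extendedCentroid R, x = c * toSymmetricQuotient R a + d :=
  Iff.rfl

/-- If the inner derivations of `a` and `b` compose to zero and `a` is noncentral, then
`b ∈ C a + C`. -/
theorem mem_affineC_of_commutator_commutator {a b : R} (ha : a ∉ Set.center R)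
    (h : ∀ r, a * (b * r - r * b) - (b * r - r * b) * a = 0) :
    toSymmetricQuotient R b ∈ affineC a := by
  have h1 : ∀ r s, (a * r - r * a) * (b * s - s * b) + (b * r - r * b) * (a * s - s * a) = 0 :=
    fun r s => by linear_combination (norm := noncomm_ring) h (r * s) - h r * s - r * h s
  have h2 : ∀ r t s, (b * r - r * b) * t * (a * s - s * a) =
      -((a * r - r * a) * t * (b * s - s * b)) := fun r t s => by
    linear_combination (norm := noncomm_ring) h1 r (t * s) - h1 r t * s
  -- By `h2` this subbimodule contains every pair ([a, r], [b, r]). The resulting c ∈ C satisfies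
  -- c[a, r] = [b, r], so b - ca commutes with R.
  let G : AddSubgroup (R × R) :=
    { carrier := {p | ∀ t s, p.2 * t * (a * s - s * a) = -(p.1 * t * (b * s - s * b))}
      zero_mem' := fun t s => by simp
      add_mem' := fun {p q} hp hq t s => by
        rw [Prod.fst_add, Prod.snd_add, add_mul, add_mul, hp, hq, add_mul, add_mul, neg_add]
      neg_mem' := fun {p} hp t s => by
        rw [Prod.fst_neg, Prod.snd_neg, neg_mul, neg_mul, hp, neg_mul, neg_mul] }
  have hmem : ∀ x y, (x, y) ∈ G ↔
      ∀ t s, y * t * (a * s - s * a) = -(x * t * (b * s - s * b)) := fun x y => Iff.rfl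
  obtain ⟨s, hs⟩ := exists_commutator_ne_zero ha
  obtain ⟨c, hc, hcG⟩ := exists_mem_extendedCentroid_of_graph G
    (fun r x y h => by
      rw [hmem] at *
      intro t s
      simp only [mul_assoc] at h ⊢
      rw [h, mul_neg])
    (fun r x y h => by
      rw [hmem] at *
      intro t s
      rw [mul_assoc y, h, mul_assoc x r t])
    (fun y h => IsPrimeRing.left_eq_zero hs fun t => by rw [(hmem _ _).1 h, zero_mul, zero_mul,
      neg_zero])
    ((hmem (a * s - s * a) (b * s - s * b)).2 (h2 s)) hs
  refine mem_affineC.2 ⟨c, hc, toSymmetricQuotient R b - c * toSymmetricQuotient R a,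
    mem_extendedCentroid_of_commute fun r => ?_, by abel⟩
  have e := hcG (a * r - r * a) (b * r - r * b) ((hmem _ _).2 (h2 r))
  have e' := mul_comm_of_mem_extendedCentroid hc (toSymmetricQuotient R r)
  simp only [map_sub, map_mul] at e
  linear_combination (norm := noncomm_ring) -e + e' * toSymmetricQuotient R a

theorem mem_affineC_of_commute {K L : AddSubgroup R} (hL : IsLieIdeal L)
    (h : ∀ k ∈ K, ∀ l ∈ L, k * l = l * k) {a b : R} (ha : a ∈ K) (hac : a ∉ Set.center R)
    (hb : b ∈ L) : toSymmetricQuotient R b ∈ affineC a :=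
  mem_affineC_of_commutator_commutator hac fun r => sub_eq_zero.2 (h a ha _ (hL b hb r))

theorem mul_mem_affineC {a : R} {c x : SymmetricQuotient R} (hc : c ∈ extendedCentroid R)
    (hx : x ∈ affineC a) : c * x ∈ affineC a := by
  obtain ⟨d, hd, e, he, rfl⟩ := mem_affineC.1 hx
  exact mem_affineC.2 ⟨c * d, mul_mem hc hd, c * e, mul_mem hc he, by rw [mul_add, mul_assoc]⟩

theorem affineC_le_affineC {a b : R} (h : toSymmetricQuotient R b ∈ affineC a) :
    affineC b ≤ affineC a := by
  intro x hx
  obtain ⟨c, hc, d, hd, rfl⟩ := mem_affineC.1 hx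
  exact add_mem (mul_mem_affineC hc h)
    (mem_affineC.2 ⟨0, zero_mem _, d, hd, by rw [zero_mul, zero_add]⟩)

theorem affineC_eq_of_commute {K L : AddSubgroup R} (hK : IsLieIdeal K) (hL : IsLieIdeal L)
    (h : ∀ k ∈ K, ∀ l ∈ L, k * l = l * k) {a b : R} (ha : a ∈ K) (hac : a ∉ Set.center R)
    (hb : b ∈ L) (hbc : b ∉ Set.center R) : affineC a = affineC b :=
  le_antisymm
    (affineC_le_affineC (mem_affineC_of_commute hK (fun l hl k hk => (h k hk l hl).symm) hb hbc ha))
    (affineC_le_affineC (mem_affineC_of_commute hL h ha hac hb))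

theorem commute_of_mem_affineC {a : R} {x y : SymmetricQuotient R} (hx : x ∈ affineC a)
    (hy : y ∈ affineC a) : x * y = y * x := by
  obtain ⟨c, hc, d, hd, rfl⟩ := mem_affineC.1 hx
  obtain ⟨c', hc', d', hd', rfl⟩ := mem_affineC.1 hy
  have h : ∀ z, z ∈ extendedCentroid R → ∀ q, Commute z q :=
    fun z hz q => (mul_comm_of_mem_extendedCentroid hz q).symm
  have ha : Commute (toSymmetricQuotient R a) (c' * toSymmetricQuotient R a + d') :=
    ((h c' hc' _).symm.mul_right (Commute.refl _)).add_right (h d' hd' _).symm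
  exact ((h c hc _).mul_left ha).add_left (h d hd _)

theorem mul_mem_mulC {K : AddSubgroup R} {k : R} (hk : k ∈ K) {c : SymmetricQuotient R}
    (hc : c ∈ extendedCentroid R) : toSymmetricQuotient R k * c ∈ mulC K :=
  AddSubgroup.mul_mem_mul' (AddSubgroup.mem_map_of_mem _ hk) hc

theorem toSymmetricQuotient_mem_mulC {K : AddSubgroup R} {k : R} (hk : k ∈ K) :
    toSymmetricQuotient R k ∈ mulC K := by
  simpa using mul_mem_mulC hk (one_mem _)

/-- A noncentral element `b` has a commutator which is not in `C b`, provided that all its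
commutators are in `C b + C`. -/
theorem exists_commutator_eq_add {b : R} (hb : b ∉ Set.center R)
    (h : ∀ r, toSymmetricQuotient R (b * r - r * b) ∈ affineC b) :
    ∃ r, ∃ c ∈ extendedCentroid R, ∃ d ∈ extendedCentroid R, d ≠ 0 ∧
      toSymmetricQuotient R (b * r - r * b) = c * toSymmetricQuotient R b + d := by
  by_contra! h0
  have h1 : ∀ r, ∃ c ∈ extendedCentroid R,
      toSymmetricQuotient R (b * r - r * b) = c * toSymmetricQuotient R b := by
    intro r
    obtain ⟨c, hc, d, hd, e⟩ := mem_affineC.1 (h r)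
    have : d = 0 := by_contra fun hd0 => h0 r c hc d hd hd0 e
    exact ⟨c, hc, by rw [e, this, add_zero]⟩
  have hb0 : b ≠ 0 := by
    rintro rfl
    exact hb Set.zero_mem_center
  obtain ⟨s, hs⟩ := exists_commutator_ne_zero hb
  obtain ⟨c, hc, e⟩ := h1 s
  have hc0 : c ≠ 0 := by
    rintro rfl
    rw [zero_mul, ← map_zero (toSymmetricQuotient R)] at e
    exact hs (toSymmetricQuotient_injective e)
  obtain ⟨c', hc', hcc⟩ := exists_mul_eq_one_of_mem_extendedCentroid hc hc0
  obtain ⟨d, hd, e2⟩ := h1 (b * s)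
  set B := toSymmetricQuotient R b with hB
  have hcom := fun z (hz : z ∈ extendedCentroid R) q => mul_comm_of_mem_extendedCentroid hz q
  -- From [b, s] = cb with c ≠ 0 and [b, bs] = b[b, s] = db it follows that cb² = db.
  obtain ⟨u, hu, hBB⟩ : ∃ u ∈ extendedCentroid R, B * B = u * B := by
    refine ⟨c' * d, mul_mem hc' hd, ?_⟩
    have e3 : toSymmetricQuotient R (b * (b * s) - b * s * b) =
        B * toSymmetricQuotient R (b * s - s * b) := by
      rw [hB, ← map_mul]
      congr 1
      noncomm_ring
    rw [e2, e, ← mul_assoc, hcom c hc] at e3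
    rw [mul_assoc, e3, ← mul_assoc, ← mul_assoc, hcom c hc c', hcc,
      one_mul]
  have hBrB : ∀ r, B * toSymmetricQuotient R r * B = u * (toSymmetricQuotient R r * B) ∧
      B * toSymmetricQuotient R r * B = u * (B * toSymmetricQuotient R r) := by
    intro r
    obtain ⟨v, hv, e3⟩ := h1 r
    simp only [map_sub, map_mul, ← hB] at e3
    have e4 := hcom v hv B
    have e5 := hcom u hu (toSymmetricQuotient R r)
    have e6 := hcom u hu v
    constructor
    · linear_combination (norm := noncomm_ring) -(B * e3) + u * e3 +
        hBB * toSymmetricQuotient R r - e4 * B - v * hBB - e6 * B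
    · linear_combination (norm := noncomm_ring) e3 * B - u * e3 + v * hBB +
        toSymmetricQuotient R r * hBB + e5 * B + e6 * B
  -- If u = 0, then bRb = 0; otherwise u[b, s] = 0. Both are impossible.
  by_cases hu0 : u = 0
  · refine hb0 (IsPrimeRing.right_eq_zero hb0 fun r => toSymmetricQuotient_injective ?_)
    rw [map_mul, map_mul, map_zero, ← hB, (hBrB r).1, hu0, zero_mul]
  · refine mul_toSymmetricQuotient_ne_zero hu hu0 hs ?_
    rw [map_sub, map_mul, map_mul, mul_sub, ← (hBrB s).1, ← (hBrB s).2, sub_self]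

theorem mulC_eq_affineC {L : AddSubgroup R} (hL : IsLieIdeal L) {b : R} (hb : b ∈ L)
    (hbc : b ∉ Set.center R) (h : ∀ x ∈ L, toSymmetricQuotient R x ∈ affineC b) :
    mulC L = affineC b := by
  refine le_antisymm (AddSubgroup.mul_le_iff.2 ?_) fun x hx => ?_
  · rintro _ ⟨x, hx, rfl⟩ c hc
    rw [mul_comm_of_mem_extendedCentroid hc]
    exact mul_mem_affineC hc (h x hx)
  -- The point is that C ⊆ LC: from [b, r] = cb + d with d ≠ 0, every v ∈ C equals ([b, r] -
  -- cb)d⁻¹v.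
  · obtain ⟨r, c, hc, d, hd, hd0, e⟩ := exists_commutator_eq_add hbc fun r => h _ (hL b hb r)
    obtain ⟨d', hd', hdd⟩ := exists_mul_eq_one_of_mem_extendedCentroid hd hd0
    obtain ⟨u, hu, v, hv, rfl⟩ := mem_affineC.1 hx
    have e1 : v = toSymmetricQuotient R (b * r - r * b) * (d' * v) -
        toSymmetricQuotient R b * (c * (d' * v)) := by
      rw [e, add_mul, ← mul_assoc d, hdd, one_mul, ← mul_assoc _ c,
        mul_comm_of_mem_extendedCentroid hc, add_sub_cancel_left]
    have e2 := mul_mem_mulC (hL b hb r) (mul_mem hd' hv)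
    have e3 := mul_mem_mulC hb (mul_mem hc (mul_mem hd' hv))
    rw [← mul_comm_of_mem_extendedCentroid hu]
    refine add_mem (mul_mem_mulC hb hu) ?_
    rw [e1]
    exact sub_mem e2 e3

end Martindale

theorem theoremD {R : Type*} [NonUnitalRing R] [IsPrimeRing R] (n : ℕ)
    (K : Fin (n + 2) → AddSubgroup R)
    (hLie : ∀ j, IsLieIdeal (K j)) (hnc : ∀ j, ¬ IsCentral (K j)) :
    (∃ I : TwoSidedIdeal R, I ≠ ⊥ ∧ (I : Set R) ⊆ lieProd (n + 1) K) ↔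
      ¬ (∀ j, ∀ a ∈ K 0, a ∉ Set.center R →
        Martindale.mulC (K 0) = Martindale.mulC (K j) ∧
          Martindale.mulC (K j) = Martindale.affineC a) := by
  have hex : ∀ j, ∃ b ∈ K j, b ∉ Set.center R := fun j => by
    simpa only [IsCentral, not_forall, exists_prop] using hnc j
  constructor
  · intro hI hcond
    obtain ⟨a, ha, hac⟩ := hex 0
    have hmem : ∀ j, ∀ x ∈ K j, Martindale.toSymmetricQuotient R x ∈ Martindale.affineC a :=
      fun j x hx => (hcond j a ha hac).2 ▸ Martindale.toSymmetricQuotient_mem_mulC hx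
    refine not_containsIdeal_lieProd (hnc 0) (fun i j x hx y hy => ?_) hI
    refine Martindale.toSymmetricQuotient_injective ?_
    rw [map_mul, map_mul]
    exact Martindale.commute_of_mem_affineC (hmem i x hx) (hmem j y hy)
  · intro hcond
    by_contra hI
    have hcomm : ∀ i : Fin (n + 1), ∀ k ∈ K i.castSucc, ∀ l ∈ K i.succ, k * l = l * k :=
      fun i k hk l hl => sub_eq_zero.1 (by_contra fun h =>
        hI (containsIdeal_lieProd hLie hnc i k hk l hl h))
    have haff : ∀ i : Fin (n + 1), ∀ a ∈ K i.castSucc, a ∉ Set.center R → ∀ b ∈ K i.succ,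
        b ∉ Set.center R → Martindale.affineC a = Martindale.affineC b :=
      fun i a ha hac b hb hbc =>
        Martindale.affineC_eq_of_commute (hLie _) (hLie _) (hcomm i) ha hac hb hbc
    -- The reference element is taken from the second factor: elements of the first factor are only
    -- known to commute with the second, not with one another.
    obtain ⟨b₁, hb₁, hb₁c⟩ := hex (Fin.succ 0)
    have hall : ∀ j, ∀ b ∈ K j, b ∉ Set.center R →
        Martindale.affineC b = Martindale.affineC b₁ := by
      intro j
      induction j using Fin.induction with
      | zero => exact fun b hb hbc => haff 0 b hb hbc b₁ hb₁ hb₁c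
      | succ i ih =>
        intro b hb hbc
        obtain ⟨a, ha, hac⟩ := hex i.castSucc
        rw [← haff i a ha hac b hb hbc, ih a ha hac]
    have hmem : ∀ j, ∀ x ∈ K j, Martindale.toSymmetricQuotient R x ∈ Martindale.affineC b₁ := by
      intro j
      cases j using Fin.cases with
      | zero =>
        exact fun x hx => Martindale.mem_affineC_of_commute (hLie 0)
          (fun l hl k hk => (hcomm 0 k hk l hl).symm) hb₁ hb₁c hx
      | succ i =>
        intro x hx
        obtain ⟨a, ha, hac⟩ := hex i.castSucc
        rw [← hall _ a ha hac]
        exact Martindale.mem_affineC_of_commute (hLie _) (hcomm i) ha hac hx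
    have hmulC : ∀ j, Martindale.mulC (K j) = Martindale.affineC b₁ := fun j => by
      obtain ⟨b, hb, hbc⟩ := hex j
      rw [← hall j b hb hbc]
      exact Martindale.mulC_eq_affineC (hLie j) hb hbc (by rw [hall j b hb hbc]; exact hmem j)
    exact hcond fun j a ha hac =>
      ⟨(hmulC 0).trans (hmulC j).symm, (hmulC j).trans (hall 0 a ha hac).symm⟩
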